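/- Let $\kappa,\tau\in\mathbb R$ and let $\mathcal N_{\kappa,\tau}=\{(x,y,z)\in\mathbb R^3: 1+\frac{\kappa}{4}(x^2+y^2)>0\}$ carry the Bianchi–Cartan–Vranceanu metric $$g_{\kappa,\tau}=\frac{dx^2+dy^2}{\beta^2}+\Big(dz+\tau\,\frac{y\,dx-x\,dy}{\beta}\Big)^2,\qquad \beta=1+\tfrac{\kappa}{4}(x^2+y^2).$$ Let $U$ be a positive $C^2$ function on an open interval $I$, let $m\neq 0$ and $a$ be real constants, and put $$\Delta=(1-2a\tau)^2+(m^2U^2-a^2)(4\tau^2-\kappa),\qquad B=\frac{2(1-2a\tau+\sqrt\Delta)}{(1+\sqrt\Delta)^2-4\tau^2m^2U^2},\qquad \xi_1=2\sqrt{\frac{m^2U^2-a^2}{(1+\sqrt\Delta)^2-4\tau^2m^2U^2}},$$ $$Q=\xi_1^2-\frac{m^4U^2U'^2(4+\kappa\xi_1^2)^2}{16\,\Delta},\qquad \xi_2=\int\frac{mU(4+\kappa\xi_1^2)}{4\xi_1^2}\sqrt{Q}\,du,\qquad \theta(u,t)=\frac tm+\int\frac{(4\tau-a\kappa)\xi_1^2-4a}{4mU\xi_1^2}\sqrt{Q}\,du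 .$$ Assume that on $I$ one has $\Delta>0$, the quantity under the root in $\xi_1$ is well defined and positive, $1+\frac\kappa4\xi_1^2>0$, and $Q>0$. Let $\psi_{[U,m,a]}(u,t)$, $u\in I$, $t\in\mathbb R$, be the helicoidal surface of the Bour family with cylindrical coordinates $(r,\theta,z)=(\xi_1(u),\,\theta(u,t),\,\xi_2(u)+a\,\theta(u,t))$, with any choice of the two antiderivatives. Its mean curvature is the sum of the principal curvatures with respect to the unit normal $N$ for which $(\partial_u\psi,\partial_t\psi,N)$ is a positive frame. Then, for every $H\in\mathbb R$, the surface $\psi_{[U,m,a]}$ has constant mean curvature $H$ if and only if $U$ satisfies on $I$ the differential equation $$H\,\sqrt{\frac{4(m^2U^2-a^2)}{(1+\sqrt\Delta)^2-4\tau^2m^2U^2}-\frac{m^4B^2U^2U'^2}{\Delta}}=2-B-m^2B\Big(\frac{UU'}{\sqrt\Delta}\Big)'.$$ -/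

import Mathlib

noncomputable section

open scoped Matrix

namespace BCV

/-! ### Surfaces in a coordinate domain of a Riemannian three-manifold

A Riemannian metric on an open subset of `ℝ³` is given by its coefficient matrix
`g p = (g_{ij}(p))`. -/

/-- The partial derivative `∂f/∂xⁱ` at `p`. -/
def pd (i : Fin 3) (f : (Fin 3 → ℝ) → ℝ) (p : Fin 3 → ℝ) : ℝ :=
  fderiv ℝ f p (Pi.single i 1)

/-- The Christoffel symbols `Γᵏᵢⱼ` of the Levi-Civita connection of the metric `g`. -/
def christoffel (g : (Fin 3 → ℝ) → Matrix (Fin 3) (Fin 3) ℝ) (p : Fin 3 → ℝ)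
    (k i j : Fin 3) : ℝ :=
  (1 / 2) * ∑ l, (g p)⁻¹ k l *
    (pd i (fun q => g q j l) p + pd j (fun q => g q i l) p - pd l (fun q => g q i j) p)

/-- The coordinate tangent vector `∂X/∂u`. -/
def dU (X : ℝ → ℝ → Fin 3 → ℝ) (u t : ℝ) : Fin 3 → ℝ := deriv (fun s => X s t) u

/-- The coordinate tangent vector `∂X/∂t`. -/
def dT (X : ℝ → ℝ → Fin 3 → ℝ) (u t : ℝ) : Fin 3 → ℝ := deriv (fun s => X u s) t

/-- The inner product `g_p(v, w)`. -/
def ip (g : (Fin 3 → ℝ) → Matrix (Fin 3) (Fin 3) ℝ) (p v w : Fin 3 → ℝ) : ℝ :=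
  v ⬝ᵥ (g p *ᵥ w)

/-- The covariant derivative, along a parametrized surface through `p`, of a coordinate tangent
vector `w = ∂ⱼX` in the coordinate direction `v = ∂ᵢX`, where `s = ∂ᵢ∂ⱼX`:
`(∇ᵢ ∂ⱼX)ᵏ = ∂ᵢ∂ⱼXᵏ + Γᵏₐᵦ vᵃ wᵝ`. -/
def covDeriv (g : (Fin 3 → ℝ) → Matrix (Fin 3) (Fin 3) ℝ) (p s v w : Fin 3 → ℝ) :
    Fin 3 → ℝ :=
  fun k => s k + ∑ i, ∑ j, christoffel g p k i j * v i * w j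

/-- A normal vector of the parametrized surface `X`: the vector that the metric identifies with
the covector `∂ᵤX × ∂ₜX`; it makes `(∂ᵤX, ∂ₜX, normal)` a positive frame of `ℝ³`. -/
def normalVec (g : (Fin 3 → ℝ) → Matrix (Fin 3) (Fin 3) ℝ) (X : ℝ → ℝ → Fin 3 → ℝ)
    (u t : ℝ) : Fin 3 → ℝ :=
  (g (X u t))⁻¹ *ᵥ (crossProduct (dU X u t) (dT X u t))

/-- The positively oriented unit normal of the parametrized surface `X`. -/
def unitNormal (g : (Fin 3 → ℝ) → Matrix (Fin 3) (Fin 3) ℝ) (X : ℝ → ℝ → Fin 3 → ℝ)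
    (u t : ℝ) : Fin 3 → ℝ :=
  (√(ip g (X u t) (normalVec g X u t) (normalVec g X u t)))⁻¹ • normalVec g X u t

/-- The mean curvature of the parametrized surface `X` with respect to its positively oriented
unit normal `N`: the trace of the second fundamental form `h(∂ᵢ,∂ⱼ) = g(∇ᵢ∂ⱼX, N)` with respect
to the first fundamental form, that is, the sum of the two principal curvatures (without a
factor `1/2`). -/
def meanCurvature (g : (Fin 3 → ℝ) → Matrix (Fin 3) (Fin 3) ℝ) (X : ℝ → ℝ → Fin 3 → ℝ)
    (u t : ℝ) : ℝ :=
  let p := X u t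
  let Xu := dU X u t
  let Xt := dT X u t
  let N := unitNormal g X u t
  let E := ip g p Xu Xu
  let F := ip g p Xu Xt
  let G := ip g p Xt Xt
  let huu := ip g p (covDeriv g p (dU (dU X) u t) Xu Xu) N
  let hut := ip g p (covDeriv g p (dU (dT X) u t) Xu Xt) N
  let htt := ip g p (covDeriv g p (dT (dT X) u t) Xt Xt) N
  (huu * G - 2 * hut * F + htt * E) / (E * G - F ^ 2)

/-! ### The Bianchi-Cartan-Vranceanu metrics -/

/-- The conformal factor `B = 1 + (κ/4)(x² + y²)`; the BCV-space is the set where it is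
positive. -/
def conf (κ : ℝ) (p : Fin 3 → ℝ) : ℝ := 1 + κ / 4 * (p 0 ^ 2 + p 1 ^ 2)

/-- The coefficients of the metric `(dx² + dy²)/B² + (dz + τ (y dx - x dy)/B)²`. -/
def metric (κ τ : ℝ) (p : Fin 3 → ℝ) : Matrix (Fin 3) (Fin 3) ℝ :=
  let η : Fin 3 → ℝ := ![τ * p 1 / conf κ p, -(τ * p 0 / conf κ p), 1]
  Matrix.diagonal ![1 / conf κ p ^ 2, 1 / conf κ p ^ 2, 0] + Matrix.vecMulVec η η

/-! ### The helicoidal surfaces of the Bour family -/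

/-- `Δ = (1 - 2aτ)² + (m²U² - a²)(4τ² - κ)`. -/
def Delta (κ τ m a : ℝ) (U : ℝ → ℝ) (u : ℝ) : ℝ :=
  (1 - 2 * a * τ) ^ 2 + (m ^ 2 * U u ^ 2 - a ^ 2) * (4 * τ ^ 2 - κ)

/-- `(m²U² - a²) / ((1 + √Δ)² - 4τ²m²U²)`, the quantity under the root in `ξ₁`. -/
def ratio (κ τ m a : ℝ) (U : ℝ → ℝ) (u : ℝ) : ℝ :=
  (m ^ 2 * U u ^ 2 - a ^ 2) /
    ((1 + √(Delta κ τ m a U u)) ^ 2 - 4 * τ ^ 2 * m ^ 2 * U u ^ 2)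

/-- `ξ₁ = 2 √((m²U² - a²) / ((1 + √Δ)² - 4τ²m²U²))`. -/
def xi1 (κ τ m a : ℝ) (U : ℝ → ℝ) (u : ℝ) : ℝ := 2 * √(ratio κ τ m a U u)

/-- The radicand `ξ₁² - m⁴U²U'²(4 + κξ₁²)²/(16Δ)`. -/
def radicand (κ τ m a : ℝ) (U : ℝ → ℝ) (u : ℝ) : ℝ :=
  xi1 κ τ m a U u ^ 2 -
    m ^ 4 * U u ^ 2 * deriv U u ^ 2 * (4 + κ * xi1 κ τ m a U u ^ 2) ^ 2 /
      (16 * Delta κ τ m a U u)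

/-- `ξ₂`, the antiderivative with value `c` at the base point `u₀`. -/
def xi2 (κ τ m a : ℝ) (U : ℝ → ℝ) (u₀ c u : ℝ) : ℝ :=
  c + ∫ s in u₀..u,
    m * U s * (4 + κ * xi1 κ τ m a U s ^ 2) / (4 * xi1 κ τ m a U s ^ 2) *
      √(radicand κ τ m a U s)

/-- `θ(u,t) = t/m + ∫ …`, the antiderivative with value `d` at the base point `u₀`. -/
def theta (κ τ m a : ℝ) (U : ℝ → ℝ) (u₀ d u t : ℝ) : ℝ :=
  t / m + (d + ∫ s in u₀..u,
    ((4 * τ - a * κ) * xi1 κ τ m a U s ^ 2 - 4 * a) / (4 * m * U s * xi1 κ τ m a U s ^ 2) *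
      √(radicand κ τ m a U s))

/-- The helicoidal surface with cylindrical coordinates `(ξ₁(u), θ(u,t), ξ₂(u) + a θ(u,t))`,
written in the Cartesian coordinates `(x, y, z)`. -/
def bourSurface (κ τ m a : ℝ) (U : ℝ → ℝ) (u₀ c d u t : ℝ) : Fin 3 → ℝ :=
  ![xi1 κ τ m a U u * Real.cos (theta κ τ m a U u₀ d u t),
    xi1 κ τ m a U u * Real.sin (theta κ τ m a U u₀ d u t),
    xi2 κ τ m a U u₀ c u + a * theta κ τ m a U u₀ d u t]

/-- `B = 2 (1 - 2aτ + √Δ) / ((1 + √Δ)² - 4τ²m²U²)` as an explicit function of `U`. -/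
def B (κ τ m a : ℝ) (U : ℝ → ℝ) (u : ℝ) : ℝ :=
  2 * ((1 - 2 * a * τ + √(Delta κ τ m a U u)) /
    ((1 + √(Delta κ τ m a U u)) ^ 2 - 4 * τ ^ 2 * m ^ 2 * U u ^ 2))

end BCV

end

open scoped Matrix

/-! Write r = ξ₁, b = 1 + κr²/4, p = r²/b and q = a − τp. The Killing field ∂_θ + a∂_z of the screw
motion has squared length p/b + q², and ξ₁ is chosen so that this equals m²U². Since 1/b = 1 − κp/4,
this is a quadratic equation in p with discriminant Δ. The root with +√Δ is taken, and √Δ = 2/b − 1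
− 2τq is the derivative of m²U² with respect to p (`bour_relations`). As p' = 2rr'/b², it follows
that rr' = b²K with K = m²UU'/√Δ, and the radicand becomes Q = r² − b²K².

The choice of ξ₂ and θ makes the induced metric du² + U²dt². The mean curvature is therefore
h(∂ᵤ,∂ᵤ) + h(∂ₜ,∂ₜ)/U², without the mixed term, and rotation invariance allows its computation in a
cylindrical frame. The result collapses to (2 − b − bK')/√Q (`helicoidal_identity`,
`meanCurvature_helicoidal`). Since b = B and Q > 0, equating this to H and multiplying by √Q gives
the differential equation. -/

namespace BCV

/-! ### The metric, its inverse and its first derivatives -/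

/-- The coefficients of the metric as an explicit matrix. -/
theorem metric_eq (κ τ : ℝ) (p : Fin 3 → ℝ) :
    metric κ τ p =
      !![1 / conf κ p ^ 2 + (τ * p 1 / conf κ p) ^ 2,
          -(τ * p 1 / conf κ p * (τ * p 0 / conf κ p)), τ * p 1 / conf κ p;
        -(τ * p 1 / conf κ p * (τ * p 0 / conf κ p)),
          1 / conf κ p ^ 2 + (τ * p 0 / conf κ p) ^ 2, -(τ * p 0 / conf κ p);
        τ * p 1 / conf κ p, -(τ * p 0 / conf κ p), 1] := by
  ext i j
  fin_cases i <;> fin_cases j <;>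
    simp [metric, Matrix.diagonal] <;> ring

/-- The inverse of the metric, the sum of the squares of an orthonormal frame. -/
theorem metric_inv (κ τ : ℝ) {p : Fin 3 → ℝ} (hp : conf κ p ≠ 0) :
    (metric κ τ p)⁻¹ =
      !![conf κ p ^ 2, 0, -(τ * p 1 * conf κ p);
        0, conf κ p ^ 2, τ * p 0 * conf κ p;
        -(τ * p 1 * conf κ p), τ * p 0 * conf κ p, 1 + τ ^ 2 * (p 0 ^ 2 + p 1 ^ 2)] := by
  apply Matrix.inv_eq_right_inv
  rw [metric_eq]
  ext i j
  fin_cases i <;> fin_cases j <;>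
    simp [Matrix.mul_apply, Fin.sum_univ_three] <;> field_simp <;> ring

theorem hasFDerivAt_coord (i : Fin 3) (p : Fin 3 → ℝ) :
    HasFDerivAt (fun q : Fin 3 → ℝ => q i)
      (ContinuousLinearMap.proj (R := ℝ) (φ := fun _ : Fin 3 => ℝ) i) p :=
  (ContinuousLinearMap.proj (R := ℝ) (φ := fun _ : Fin 3 => ℝ) i).hasFDerivAt

theorem hasFDerivAt_conf (κ : ℝ) (p : Fin 3 → ℝ) :
    HasFDerivAt (conf κ)
      ((κ / 2 * p 0) • ContinuousLinearMap.proj (R := ℝ) (φ := fun _ : Fin 3 => ℝ) 0 +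
        (κ / 2 * p 1) • ContinuousLinearMap.proj (R := ℝ) (φ := fun _ : Fin 3 => ℝ) 1) p := by
  have h := (((hasFDerivAt_coord 0 p).pow 2).add
    ((hasFDerivAt_coord 1 p).pow 2)).const_mul (κ / 4) |>.const_add 1
  refine HasFDerivAt.congr_fderiv (f := conf κ) h ?_
  ext v
  simp
  ring

/-- The partial derivatives of the components of `τ (y dx - x dy)/B`. -/
theorem hasFDerivAt_coord_div_conf (κ c : ℝ) (j : Fin 3) {p : Fin 3 → ℝ} (hp : conf κ p ≠ 0) :
    HasFDerivAt (fun q => c * q j / conf κ q)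
      ((c / conf κ p) • ContinuousLinearMap.proj (R := ℝ) (φ := fun _ : Fin 3 => ℝ) j -
        (c * p j / conf κ p ^ 2) •
          ((κ / 2 * p 0) • ContinuousLinearMap.proj (R := ℝ) (φ := fun _ : Fin 3 => ℝ) 0 +
        (κ / 2 * p 1) • ContinuousLinearMap.proj (R := ℝ) (φ := fun _ : Fin 3 => ℝ) 1)) p := by
  have h := ((hasFDerivAt_coord j p).const_mul c).fun_mul ((hasDerivAt_inv hp).comp_hasFDerivAt p
    (hasFDerivAt_conf κ p))
  refine HasFDerivAt.congr_fderiv (h.congr_of_eventuallyEq (.of_forall fun q => ?_)) ?_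
  · simp [div_eq_mul_inv]
  ext v
  simp
  field_simp
  ring

theorem hasFDerivAt_inv_conf_sq (κ : ℝ) {p : Fin 3 → ℝ} (hp : conf κ p ≠ 0) :
    HasFDerivAt (fun q => 1 / conf κ q ^ 2)
      ((-2 / conf κ p ^ 3) •
          ((κ / 2 * p 0) • ContinuousLinearMap.proj (R := ℝ) (φ := fun _ : Fin 3 => ℝ) 0 +
        (κ / 2 * p 1) • ContinuousLinearMap.proj (R := ℝ) (φ := fun _ : Fin 3 => ℝ) 1)) p := by
  have h := ((hasDerivAt_inv hp).comp_hasFDerivAt p (hasFDerivAt_conf κ p)).pow 2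
  refine HasFDerivAt.congr_fderiv (h.congr_of_eventuallyEq (.of_forall fun q => ?_)) ?_
  · simp [div_eq_mul_inv]
  ext v
  simp
  field_simp

/-- The partial derivatives of the metric coefficients. -/
theorem pd_metric (κ τ : ℝ) {p : Fin 3 → ℝ} (hp : conf κ p ≠ 0) (i j k : Fin 3) :
    pd i (fun q => metric κ τ q j k) p =
      (!![-κ * ![p 0, p 1, 0] i / conf κ p ^ 3, 0, 0;
          0, -κ * ![p 0, p 1, 0] i / conf κ p ^ 3, 0; 0, 0, 0] : Matrix (Fin 3) (Fin 3) ℝ) j k +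
      ![τ * p 1 / conf κ p, -(τ * p 0 / conf κ p), 1] j *
        ![τ * ![0, 1, 0] i / conf κ p - τ * κ * p 1 * ![p 0, p 1, 0] i / (2 * conf κ p ^ 2),
          -(τ * ![1, 0, 0] i / conf κ p - τ * κ * p 0 * ![p 0, p 1, 0] i / (2 * conf κ p ^ 2)), 0] k +
      ![τ * p 1 / conf κ p, -(τ * p 0 / conf κ p), 1] k *
        ![τ * ![0, 1, 0] i / conf κ p - τ * κ * p 1 * ![p 0, p 1, 0] i / (2 * conf κ p ^ 2),
          -(τ * ![1, 0, 0] i / conf κ p - τ * κ * p 0 * ![p 0, p 1, 0] i / (2 * conf κ p ^ 2)), 0] j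
      := by
  have h0 := hasFDerivAt_coord_div_conf κ τ 0 hp
  have h1 := hasFDerivAt_coord_div_conf κ τ 1 hp
  have hc := hasFDerivAt_inv_conf_sq κ hp
  simp only [metric_eq, pd]
  fin_cases j <;> fin_cases k <;>
    simp only [Fin.mk_one, Fin.zero_eta, Fin.reduceFinMk, Fin.isValue, Matrix.of_apply,
      Matrix.cons_val', Matrix.cons_val_zero, Matrix.cons_val_one, Matrix.cons_val,
      Matrix.cons_val_fin_one]
  · rw [(hc.fun_add (h1.pow 2)).fderiv]
    fin_cases i <;> simp <;> field_simp <;> ring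
  · rw [((h1.fun_mul h0).fun_neg).fderiv]
    fin_cases i <;> simp <;> field_simp <;> ring
  · rw [h1.fderiv]
    fin_cases i <;> simp <;> field_simp
  · rw [((h1.fun_mul h0).fun_neg).fderiv]
    fin_cases i <;> simp <;> field_simp <;> ring
  · rw [(hc.fun_add (h0.pow 2)).fderiv]
    fin_cases i <;> simp <;> field_simp <;> ring
  · rw [(h0.fun_neg).fderiv]
    fin_cases i <;> simp <;> field_simp
  · rw [h1.fderiv]
    fin_cases i <;> simp <;> field_simp
  · rw [(h0.fun_neg).fderiv]
    fin_cases i <;> simp <;> field_simp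
  · fin_cases i <;> simp

/-! ### Covariant derivatives paired with a covector -/

theorem metric_isSymm (κ τ : ℝ) (p : Fin 3 → ℝ) : (metric κ τ p).IsSymm := by
  rw [metric_eq]
  ext i j
  fin_cases i <;> fin_cases j <;> simp

theorem isUnit_det_metric (κ τ : ℝ) {p : Fin 3 → ℝ} (hp : conf κ p ≠ 0) :
    IsUnit (metric κ τ p).det := by
  have h : (metric κ τ p).det = 1 / conf κ p ^ 4 := by
    rw [metric_eq, Matrix.det_fin_three]
    simp
    field_simp
    ring
  rw [h, isUnit_iff_ne_zero]
  positivity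

/-- Pairing with the vector that the metric identifies with a covector. -/
theorem ip_metric_inv_mulVec (κ τ : ℝ) {p : Fin 3 → ℝ} (hp : conf κ p ≠ 0) (v n : Fin 3 → ℝ) :
    ip (metric κ τ) p v ((metric κ τ p)⁻¹ *ᵥ n) = v ⬝ᵥ n := by
  rw [ip, Matrix.mulVec_mulVec, Matrix.mul_nonsing_inv _ (isUnit_det_metric κ τ hp),
    Matrix.one_mulVec]

/-- The contraction of the Christoffel symbols with a covector is a Christoffel symbol of the
first kind. -/
theorem sum_mul_christoffel {g : (Fin 3 → ℝ) → Matrix (Fin 3) (Fin 3) ℝ} {p : Fin 3 → ℝ}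
    (hg : (g p).IsSymm) (n : Fin 3 → ℝ) (i j : Fin 3) :
    ∑ k, n k * christoffel g p k i j =
      (1 / 2) * ∑ l, ((g p)⁻¹ *ᵥ n) l *
        (pd i (fun q => g q j l) p + pd j (fun q => g q i l) p - pd l (fun q => g q i j) p) := by
  have hs : ∀ k l, (g p)⁻¹ k l = (g p)⁻¹ l k := fun k l => by
    have h : ((g p)⁻¹)ᵀ = (g p)⁻¹ := by rw [Matrix.transpose_nonsing_inv, hg]
    exact congrFun (congrFun h l) k
  simp only [christoffel, Fin.sum_univ_three, Matrix.mulVec, dotProduct]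
  rw [hs 1 0, hs 2 0, hs 2 1]
  ring

/-- The Christoffel symbols of the metric, evaluated on a tangent vector `v` and paired with a
covector `n` that corresponds to the tangent vector `N`. -/
theorem dotProduct_covDeriv (κ τ : ℝ) {p : Fin 3 → ℝ} (hp : conf κ p ≠ 0) (s v n N : Fin 3 → ℝ)
    (hN : (metric κ τ p)⁻¹ *ᵥ n = N) :
    covDeriv (metric κ τ) p s v v ⬝ᵥ n = s ⬝ᵥ n
      - κ * (p 0 * v 0 + p 1 * v 1) * (v 0 * N 0 + v 1 * N 1) / conf κ p ^ 3
      + κ * (p 0 * N 0 + p 1 * N 1) * (v 0 ^ 2 + v 1 ^ 2) / (2 * conf κ p ^ 3)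
      + τ * κ * (p 0 * v 1 - p 1 * v 0) * (p 0 * v 0 + p 1 * v 1) / (2 * conf κ p ^ 2) *
        (N 2 + τ * p 1 / conf κ p * N 0 - τ * p 0 / conf κ p * N 1)
      - 2 * τ / conf κ p ^ 2 * (v 0 * N 1 - v 1 * N 0) *
        (v 2 + τ * p 1 / conf κ p * v 0 - τ * p 0 / conf κ p * v 1) := by
  have h1 : covDeriv (metric κ τ) p s v v ⬝ᵥ n = s ⬝ᵥ n +
      ∑ i, ∑ j, (∑ k, n k * christoffel (metric κ τ) p k i j) * v i * v j := by
    simp only [covDeriv, dotProduct, Fin.sum_univ_three]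
    ring
  rw [h1]
  simp only [sum_mul_christoffel (metric_isSymm κ τ p), hN, pd_metric κ τ hp]
  -- The form η = dz + τ(y dx − x dy)/b satisfies dη = −(2τ/b²) dx∧dy only after κ(x² + y²)/4 is
  -- replaced by b − 1. This accounts for the multiplier of `hc` below.
  have hc : κ / 4 * (p 0 ^ 2 + p 1 ^ 2) = conf κ p - 1 := by rw [conf]; ring
  generalize conf κ p = b at *
  simp [Fin.sum_univ_three]
  linear_combination (norm := skip) 2 * τ / b ^ 2 * (v 0 * N 1 - v 1 * N 0) *
    (v 2 + τ * p 1 / b * v 0 - τ * p 0 / b * v 1) * hc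
  field_simp
  ring

/-! ### The metric in cylindrical frames -/

/-- The vector with components `(v, w, z)` in the cylindrical frame at angle `θ`. -/
noncomputable def cyl (θ v w z : ℝ) : Fin 3 → ℝ :=
  ![v * Real.cos θ - w * Real.sin θ, v * Real.sin θ + w * Real.cos θ, z]

theorem conf_cyl (κ θ r z : ℝ) : conf κ (cyl θ r 0 z) = 1 + κ / 4 * r ^ 2 := by
  simp only [conf, cyl, Matrix.cons_val_zero, Matrix.cons_val_one]
  linear_combination κ / 4 * r ^ 2 * Real.sin_sq_add_cos_sq θ

theorem dotProduct_cyl (θ v w z v' w' z' : ℝ) :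
    cyl θ v w z ⬝ᵥ cyl θ v' w' z' = v * v' + w * w' + z * z' := by
  simp only [dotProduct, cyl, Fin.sum_univ_three, Matrix.cons_val]
  linear_combination (v * v' + w * w') * Real.sin_sq_add_cos_sq θ

theorem crossProduct_cyl (θ v w z v' w' z' : ℝ) :
    crossProduct (cyl θ v w z) (cyl θ v' w' z') =
      cyl θ (w * z' - z * w') (z * v' - v * z') (v * w' - w * v') := by
  rw [cross_apply]
  ext i
  fin_cases i <;> simp [cyl]
  · ring
  · ring
  · linear_combination (v * w' - w * v') * Real.sin_sq_add_cos_sq θ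

theorem smul_cyl (c θ v w z : ℝ) : c • cyl θ v w z = cyl θ (c * v) (c * w) (c * z) := by
  ext i
  fin_cases i <;> simp [cyl] <;> ring

theorem metric_mulVec_cyl (κ τ θ r z v w y : ℝ) (h : 1 + κ / 4 * r ^ 2 ≠ 0) :
    metric κ τ (cyl θ r 0 z) *ᵥ cyl θ v w y =
      cyl θ (v / (1 + κ / 4 * r ^ 2) ^ 2)
        (w / (1 + κ / 4 * r ^ 2) ^ 2 -
          τ * r / (1 + κ / 4 * r ^ 2) * (y - τ * r * w / (1 + κ / 4 * r ^ 2)))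
        (y - τ * r * w / (1 + κ / 4 * r ^ 2)) := by
  rw [metric_eq, conf_cyl]
  generalize 1 + κ / 4 * r ^ 2 = b at *
  have hs := Real.sin_sq_add_cos_sq θ
  ext i
  fin_cases i <;> simp [cyl, Matrix.mulVec, dotProduct, Fin.sum_univ_three]
  · linear_combination (norm := skip) -(τ ^ 2 * r ^ 2 * w * Real.sin θ / b ^ 2) * hs
    field_simp
    ring
  · linear_combination (norm := skip) (τ ^ 2 * r ^ 2 * w * Real.cos θ / b ^ 2) * hs
    field_simp
    ring
  · linear_combination (norm := skip) -(τ * r * w / b) * hs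
    field_simp
    ring

/-- Rotations about the z-axis are isometries, so θ drops out. The last product consists of the
values of η on the two vectors. -/
theorem ip_cyl (κ τ θ r z v w y v' w' y' : ℝ) (h : 1 + κ / 4 * r ^ 2 ≠ 0) :
    ip (metric κ τ) (cyl θ r 0 z) (cyl θ v w y) (cyl θ v' w' y') =
      (v * v' + w * w') / (1 + κ / 4 * r ^ 2) ^ 2 +
        (y - τ * r * w / (1 + κ / 4 * r ^ 2)) * (y' - τ * r * w' / (1 + κ / 4 * r ^ 2)) := by
  rw [ip, metric_mulVec_cyl κ τ θ r z v' w' y' h, dotProduct_cyl]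
  generalize 1 + κ / 4 * r ^ 2 = b at *
  field_simp
  ring

theorem metric_inv_mulVec_cyl (κ τ θ r z v w y : ℝ) (h : 1 + κ / 4 * r ^ 2 ≠ 0) :
    (metric κ τ (cyl θ r 0 z))⁻¹ *ᵥ cyl θ v w y =
      cyl θ ((1 + κ / 4 * r ^ 2) ^ 2 * v)
        ((1 + κ / 4 * r ^ 2) * ((1 + κ / 4 * r ^ 2) * w + τ * r * y))
        (τ * r * ((1 + κ / 4 * r ^ 2) * w + τ * r * y) + y) := by
  have hc : conf κ (cyl θ r 0 z) ≠ 0 := by rwa [conf_cyl]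
  rw [metric_inv κ τ hc, conf_cyl]
  have hs := Real.sin_sq_add_cos_sq θ
  ext i
  fin_cases i <;> simp [cyl, Matrix.mulVec, dotProduct, Fin.sum_univ_three]
  · ring
  · ring
  · linear_combination (τ ^ 2 * r ^ 2 * y + τ * r * (1 + κ / 4 * r ^ 2) * w) * hs

/-- The Cartesian formula involves only horizontal dot products, horizontal wedge products and
values of η, all independent of the angle. -/
theorem dotProduct_covDeriv_cyl (κ τ θ r z : ℝ) (h : 1 + κ / 4 * r ^ 2 ≠ 0)
    (s₁ s₂ s₃ v₁ v₂ v₃ n₁ n₂ n₃ : ℝ) :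
    covDeriv (metric κ τ) (cyl θ r 0 z) (cyl θ s₁ s₂ s₃) (cyl θ v₁ v₂ v₃) (cyl θ v₁ v₂ v₃) ⬝ᵥ
        cyl θ n₁ n₂ n₃ =
      s₁ * n₁ + s₂ * n₂ + s₃ * n₃
      - κ * r * v₁ * (v₁ * n₁ / (1 + κ / 4 * r ^ 2) +
          v₂ * ((1 + κ / 4 * r ^ 2) * n₂ + τ * r * n₃) / (1 + κ / 4 * r ^ 2) ^ 2)
      + κ * r * n₁ * (v₁ ^ 2 + v₂ ^ 2) / (2 * (1 + κ / 4 * r ^ 2))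
      + τ * κ * r ^ 2 * v₁ * v₂ * n₃ / (2 * (1 + κ / 4 * r ^ 2) ^ 2)
      - 2 * τ * (v₁ * ((1 + κ / 4 * r ^ 2) * n₂ + τ * r * n₃) / (1 + κ / 4 * r ^ 2) - v₂ * n₁) *
        (v₃ - τ * r * v₂ / (1 + κ / 4 * r ^ 2)) := by
  have hc : conf κ (cyl θ r 0 z) ≠ 0 := by rwa [conf_cyl]
  rw [dotProduct_covDeriv κ τ hc _ _ _ _ (metric_inv_mulVec_cyl κ τ θ r z n₁ n₂ n₃ h),
    dotProduct_cyl, conf_cyl]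
  generalize 1 + κ / 4 * r ^ 2 = b at *
  have hs := Real.sin_sq_add_cos_sq θ
  have dot : ∀ v w y v' w' y' : ℝ, cyl θ v w y 0 * cyl θ v' w' y' 0 +
      cyl θ v w y 1 * cyl θ v' w' y' 1 = v * v' + w * w' := fun v w y v' w' y' => by
    simp only [cyl, Matrix.cons_val]
    linear_combination (v * v' + w * w') * hs
  have wedge : ∀ v w y v' w' y' : ℝ, cyl θ v w y 0 * cyl θ v' w' y' 1 -
      cyl θ v w y 1 * cyl θ v' w' y' 0 = v * w' - w * v' := fun v w y v' w' y' => by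
    simp only [cyl, Matrix.cons_val]
    linear_combination (v * w' - w * v') * hs
  have eta : ∀ v w y : ℝ, cyl θ v w y 2 + τ * cyl θ r 0 z 1 / b * cyl θ v w y 0 -
      τ * cyl θ r 0 z 0 / b * cyl θ v w y 1 = y - τ * r * w / b := fun v w y => by
    have := wedge r 0 z v w y
    have h2 : cyl θ v w y 2 = y := rfl
    rw [h2]
    linear_combination -(τ / b) * this
  rw [eta, eta, wedge, wedge, dot, dot, dot, pow_two (cyl θ v₁ v₂ v₃ 0),
    pow_two (cyl θ v₁ v₂ v₃ 1), dot]
  field_simp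
  ring

/-! ### Mean curvature of helicoidal surfaces in natural parameters -/

/-- The mean curvature with respect to orthogonal coordinates, in terms of the normal covector. -/
theorem meanCurvature_of_orthogonal (κ τ : ℝ) (X : ℝ → ℝ → Fin 3 → ℝ) (u t : ℝ)
    (hc : conf κ (X u t) ≠ 0) (hF : ip (metric κ τ) (X u t) (dU X u t) (dT X u t) = 0)
    {n : Fin 3 → ℝ} (hn : crossProduct (dU X u t) (dT X u t) = n) {G l : ℝ} (hG0 : G ≠ 0)
    (hE : ip (metric κ τ) (X u t) (dU X u t) (dU X u t) = 1)
    (hG : ip (metric κ τ) (X u t) (dT X u t) (dT X u t) = G)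
    (hl : (metric κ τ (X u t))⁻¹ *ᵥ n ⬝ᵥ n = l ^ 2) (hl0 : 0 ≤ l) :
    meanCurvature (metric κ τ) X u t =
      (covDeriv (metric κ τ) (X u t) (dU (dU X) u t) (dU X u t) (dU X u t) ⬝ᵥ n +
        covDeriv (metric κ τ) (X u t) (dT (dT X) u t) (dT X u t) (dT X u t) ⬝ᵥ n / G) / l := by
  have hN : ∀ v, ip (metric κ τ) (X u t) v (unitNormal (metric κ τ) X u t) = v ⬝ᵥ n / l := by
    intro v
    rw [unitNormal, normalVec, hn, ip_metric_inv_mulVec κ τ hc, hl, Real.sqrt_sq hl0, ip,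
      Matrix.mulVec_smul, dotProduct_smul, ← ip, ip_metric_inv_mulVec κ τ hc, smul_eq_mul]
    ring
  simp only [meanCurvature, hN, hF, hE, hG]
  rw [div_eq_iff (by simpa using hG0)]
  field_simp
  ring

/-- The algebraic identity behind the mean curvature of a helicoidal surface, with `r = P * b` the
distance to the axis, `b` the conformal factor and `q = a - τ r² / b`. -/
theorem helicoidal_identity {b P q τ ρ σ M k θ'' : ℝ} (hb : b ≠ 0) (hP : P ≠ 0) (hM : M ≠ 0)
    (hσ : σ ≠ 0) (hM2 : M ^ 2 = P ^ 2 + q ^ 2) (hσ2 : σ ^ 2 = 1 - ρ ^ 2)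
    {κ r a r' r'' θ' ζ' ζ'' n₁ n₂ n₃ : ℝ} (hr : r = P * b) (hκ : κ = 4 * (b - 1) / (P * b) ^ 2)
    (ha : a = q + τ * P ^ 2 * b) (hr' : r' = b * ρ)
    (hr'' : r'' = 4 * (b - 1) * ρ ^ 2 / P + b * k / P - b * ρ ^ 2 / P)
    (hθ' : θ' = -(q * σ / (M * P))) (hζ' : ζ' = M * σ / P)
    (hζ'' : ζ'' = (2 / b - 1 - 2 * τ * q) * ρ * σ / M + 2 * M * (b - 1) * ρ * σ / (P ^ 2 * b) +
      M * (b * ρ - 2 * (b - 1) * ρ ^ 3 - b * ρ * k) / (P ^ 2 * b * σ) - 2 * M * σ * ρ / P ^ 2)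
    (hn₁ : n₁ = -(r * ζ')) (hn₂ : n₂ = -(a * r')) (hn₃ : n₃ = r * r') :
    (r'' - r * θ' ^ 2) * n₁ + (2 * r' * θ' + r * θ'') * n₂ + (ζ'' + a * θ'') * n₃
      - κ * r * r' * (r' * n₁ / b + r * θ' * (b * n₂ + τ * r * n₃) / b ^ 2)
      + κ * r * n₁ * (r' ^ 2 + (r * θ') ^ 2) / (2 * b)
      + τ * κ * r ^ 2 * r' * (r * θ') * n₃ / (2 * b ^ 2)
      - 2 * τ * (r' * (b * n₂ + τ * r * n₃) / b - r * θ' * n₁) *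
        (ζ' + a * θ' - τ * r * (r * θ') / b)
      + (-(r * n₁) + κ * r * n₁ * r ^ 2 / (2 * b) + 2 * τ * (r * n₁) * (a - τ * r * r / b)) / M ^ 2
    = M * b ^ 2 * (2 - b - b * k) / (r * σ) := by
  subst hr hκ ha hr' hr'' hθ' hζ' hζ'' hn₁ hn₂ hn₃
  -- The terms in θ'' cancel because r n₂ + a n₃ = 0. What remains is a polynomial identity modulo
  -- the relations for M² and σ².
  field_simp
  have hs4 : σ ^ 4 = (1 - ρ ^ 2) ^ 2 := by rw [← hσ2]; ring
  ring_nf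
  simp only [hM2, hσ2, hs4]
  ring

/-- The mean curvature of a helicoidal surface in natural parameters: `r` is the distance to the
axis, `b` the conformal factor, `K = r r' / b²`, and `lam² = r² - b² K²`. -/
theorem meanCurvature_helicoidal {κ τ m a : ℝ} {X : ℝ → ℝ → Fin 3 → ℝ} {u t : ℝ}
    {θ z r r' r'' θ' θ'' ζ' ζ'' b b' q K k U w lam : ℝ}
    (hm : m ≠ 0) (hr : 0 < r) (hb : 0 < b) (hU : 0 < U) (hlam : 0 < lam)
    (hbr : b = 1 + κ / 4 * r ^ 2) (hq : q = a - τ * r ^ 2 / b)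
    (hM2 : (m * U) ^ 2 = r ^ 2 / b ^ 2 + q ^ 2) (hlam2 : lam ^ 2 = r ^ 2 - b ^ 2 * K ^ 2)
    (hr' : r' = b ^ 2 * K / r) (hb' : b' = κ / 2 * r * r') (hw : w = 2 / b - 1 - 2 * τ * q)
    (hr'' : r'' = (2 * b * b' * K + b ^ 2 * k) / r - b ^ 2 * K * r' / r ^ 2)
    (hθ' : θ' = -(b * q * lam) / (m * U * r ^ 2)) (hζ' : ζ' = m * U * b * lam / r ^ 2)
    (hζ'' : ζ'' = w * K * b * lam / (m * U * r ^ 2) + m * U * b' * lam / r ^ 2 +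
      m * U * b * ((r * r' - b * b' * K ^ 2 - b ^ 2 * K * k) / lam) / r ^ 2 -
      2 * m * U * b * lam * r' / r ^ 3)
    (hX : X u t = cyl θ r 0 z) (hXu : dU X u t = cyl θ r' (r * θ') (ζ' + a * θ'))
    (hXt : dT X u t = cyl θ 0 (r / m) (a / m))
    (hXuu : dU (dU X) u t =
      cyl θ (r'' - r * θ' ^ 2) (2 * r' * θ' + r * θ'') (ζ'' + a * θ''))
    (hXtt : dT (dT X) u t = cyl θ (-(r / m ^ 2)) 0 0) :
    meanCurvature (metric κ τ) X u t = (2 - b - b * k) / lam := by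
  have hbr0 : 1 + κ / 4 * r ^ 2 ≠ 0 := hbr ▸ hb.ne'
  have hκ : κ = 4 * (b - 1) / r ^ 2 := by rw [hbr]; field_simp; ring
  have ha : a = q + τ * r ^ 2 / b := by rw [hq]; ring
  have hcross : crossProduct (dU X u t) (dT X u t) =
      m⁻¹ • cyl θ (-(r * ζ')) (-(a * r')) (r * r') := by
    rw [hXu, hXt, crossProduct_cyl, smul_cyl]
    congr 1
    · field_simp; ring
    · field_simp; ring
    · field_simp; ring
  have hηu : ζ' + a * θ' - τ * r * (r * θ') / b = ζ' + q * θ' := by rw [ha]; ring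
  have hηt : a / m - τ * r * (r / m) / b = q / m := by rw [ha]; field_simp; ring
  -- Orthogonality holds because θ' = −qζ'/(mU)².
  have hF : ip (metric κ τ) (X u t) (dU X u t) (dT X u t) = 0 := by
    rw [hXu, hXt, hX, ip_cyl _ _ _ _ _ _ _ _ _ _ _ hbr0, ← hbr, hηu, hηt]
    have : (r' * 0 + r * θ' * (r / m)) / b ^ 2 + (ζ' + q * θ') * (q / m) =
        (θ' * (r ^ 2 / b ^ 2 + q ^ 2) + q * ζ') / m := by ring
    rw [this, ← hM2, hθ', hζ']
    field_simp
    ring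
  -- The radial part contributes b²K²/r² and the rest contributes lam²/r²; these add up to 1.
  have hE : ip (metric κ τ) (X u t) (dU X u t) (dU X u t) = 1 := by
    rw [hXu, hX, ip_cyl _ _ _ _ _ _ _ _ _ _ _ hbr0, ← hbr, hηu]
    have h1 : (r' * r' + r * θ' * (r * θ')) / b ^ 2 + (ζ' + q * θ') * (ζ' + q * θ') =
        r' ^ 2 / b ^ 2 + θ' ^ 2 * (r ^ 2 / b ^ 2 + q ^ 2) + 2 * q * ζ' * θ' + ζ' ^ 2 := by ring
    have h2 : θ' ^ 2 * (m * U) ^ 2 + 2 * q * ζ' * θ' + ζ' ^ 2 =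
        b ^ 2 * lam ^ 2 * ((m * U) ^ 2 - q ^ 2) / r ^ 4 := by
      rw [hθ', hζ']
      field_simp
      ring
    rw [h1, ← hM2, add_assoc, add_assoc, ← add_assoc (_ * _), h2, hM2, hlam2, hr']
    field_simp
    ring
  have hG : ip (metric κ τ) (X u t) (dT X u t) (dT X u t) = U ^ 2 := by
    rw [hXt, hX, ip_cyl _ _ _ _ _ _ _ _ _ _ _ hbr0, ← hbr, hηt]
    have : (0 * 0 + r / m * (r / m)) / b ^ 2 + q / m * (q / m) =
        (r ^ 2 / b ^ 2 + q ^ 2) / m ^ 2 := by ring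
    rw [this, ← hM2]
    field_simp
  -- The squared norm of a cross product covector is (EG − F²)/det g, here U² divided by b⁻⁴.
  have hl : (metric κ τ (X u t))⁻¹ *ᵥ (m⁻¹ • cyl θ (-(r * ζ')) (-(a * r')) (r * r')) ⬝ᵥ
      (m⁻¹ • cyl θ (-(r * ζ')) (-(a * r')) (r * r')) = (U * b ^ 2) ^ 2 := by
    rw [hX, Matrix.mulVec_smul, smul_dotProduct, dotProduct_smul,
      metric_inv_mulVec_cyl _ _ _ _ _ _ _ _ hbr0, dotProduct_cyl, ← hbr]
    have h1 : m⁻¹ • m⁻¹ • (b ^ 2 * -(r * ζ') * -(r * ζ') +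
        b * (b * -(a * r') + τ * r * (r * r')) * -(a * r') +
        (τ * r * (b * -(a * r') + τ * r * (r * r')) + r * r') * (r * r')) =
        (b ^ 2 * r ^ 2 * ζ' ^ 2 + b ^ 2 * r' ^ 2 * (r ^ 2 / b ^ 2 + q ^ 2)) / m ^ 2 := by
      rw [hq, smul_eq_mul, smul_eq_mul]
      field_simp
      ring
    rw [h1, ← hM2, hζ']
    have h2 : b ^ 2 * r ^ 2 * (m * U * b * lam / r ^ 2) ^ 2 + b ^ 2 * r' ^ 2 * (m * U) ^ 2 =
        b ^ 2 * (m * U) ^ 2 * (b ^ 2 * lam ^ 2 / r ^ 2 + r' ^ 2) := by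
      field_simp
    rw [h2, hlam2, hr']
    field_simp
    ring
  rw [meanCurvature_of_orthogonal κ τ X u t (by rwa [hX, conf_cyl]) hF hcross (by positivity)
    hE hG hl (by positivity), hXu, hXt, hXuu, hXtt, hX, dotProduct_smul, dotProduct_smul,
    dotProduct_covDeriv_cyl _ _ _ _ _ hbr0, dotProduct_covDeriv_cyl _ _ _ _ _ hbr0, ← hbr]
  -- In these normalized variables ρ² + σ² = 1 expresses unit speed, and M² = P² + q² is m² times
  -- the squared length of ∂ₜX.
  have key := helicoidal_identity (b := b) (P := r / b) (q := q) (τ := τ) (ρ := r' / b)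
    (σ := lam / r) (M := m * U) (k := k) (θ'' := θ'') hb.ne' (by positivity) (by positivity)
    (by positivity) (by rw [hM2]; ring) (by rw [div_pow, hlam2, hr']; field_simp)
    (κ := κ) (r := r) (a := a) (r' := r') (r'' := r'') (θ' := θ') (ζ' := ζ') (ζ'' := ζ'')
    (by field_simp) (by rw [hκ]; field_simp) (by rw [ha]; field_simp) (by field_simp)
    (by rw [hr'', hb', hκ, hr']; field_simp) (by rw [hθ']; field_simp)
    (by rw [hζ']; field_simp)
    (by rw [hζ'', hb', hw, hκ, hr']; field_simp; ring) rfl rfl rfl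
  have hl' : (2 - b - b * k) / lam =
      m⁻¹ * (m * U * b ^ 2 * (2 - b - b * k) / (r * (lam / r))) / (U * b ^ 2) := by
    field_simp
  rw [hl', ← key, smul_eq_mul, smul_eq_mul]
  congr 1
  rw [mul_add, mul_div_assoc, ← sub_eq_zero]
  field_simp
  ring

/-! ### Differentiation in moving frames and of integrals -/

/-- Differentiation of a vector given in a moving cylindrical frame. -/
theorem hasDerivAt_cyl {θ v w z : ℝ → ℝ} {θ' v' w' z' s : ℝ} (hθ : HasDerivAt θ θ' s)
    (hv : HasDerivAt v v' s) (hw : HasDerivAt w w' s) (hz : HasDerivAt z z' s) :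
    HasDerivAt (fun x => cyl (θ x) (v x) (w x) (z x))
      (cyl (θ s) (v' - w s * θ') (w' + v s * θ') z') s := by
  rw [hasDerivAt_pi]
  intro i
  fin_cases i
  · refine ((hv.mul hθ.cos).sub (hw.mul hθ.sin)).congr_deriv ?_
    simp [cyl]
    ring
  · refine ((hv.mul hθ.sin).add (hw.mul hθ.cos)).congr_deriv ?_
    simp [cyl]
    ring
  · simpa [cyl] using hz

/-- On an open interval the integral of a continuous function is differentiable. -/
theorem hasDerivAt_integral_of_continuousOn {I : Set ℝ} (hIo : IsOpen I) (hIc : I.OrdConnected)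
    {f : ℝ → ℝ} (hf : ContinuousOn f I) {u₀ u : ℝ} (hu₀ : u₀ ∈ I) (hu : u ∈ I) :
    HasDerivAt (fun x => ∫ s in u₀..x, f s) (f u) u :=
  intervalIntegral.integral_hasDerivAt_right
    (hf.mono (hIc.uIcc_subset hu₀ hu)).intervalIntegrable
    (hf.stronglyMeasurableAtFilter hIo u hu) (hf.continuousAt (hIo.mem_nhds hu))

/-! ### Algebra of the Bour family -/

/-- The conformal factor at distance `2 √R` from the axis, where `R = (v - a²) / D`. -/
theorem conf_ratio {κ τ a v w D R : ℝ} (hD : D = (1 + w) ^ 2 - 4 * τ ^ 2 * v)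
    (hw : w ^ 2 = (1 - 2 * a * τ) ^ 2 + (v - a ^ 2) * (4 * τ ^ 2 - κ))
    (hR : R = (v - a ^ 2) / D) (hD0 : D ≠ 0) :
    1 + κ * R = 2 * ((1 - 2 * a * τ + w) / D) := by
  rw [hR]
  field_simp
  linear_combination hD + hw

/-- The relations that express `v = m² U²` and `w = √Δ` through the distance `2 √R` to the axis and
the conformal factor `b`. -/
theorem bour_relations {κ τ a v w D R b q : ℝ} (hD : D = (1 + w) ^ 2 - 4 * τ ^ 2 * v)
    (hw : w ^ 2 = (1 - 2 * a * τ) ^ 2 + (v - a ^ 2) * (4 * τ ^ 2 - κ))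
    (hR : R = (v - a ^ 2) / D) (hD0 : D ≠ 0) (hb0 : b ≠ 0) (hb : b = 1 + κ * R)
    (hq : q = a - τ * (4 * R) / b) :
    v = 4 * R / b ^ 2 + q ^ 2 ∧ w = 2 / b - 1 - 2 * τ * q := by
  have hb' := hb.trans (conf_ratio hD hw hR hD0)
  set c := 1 - 2 * a * τ + w with hc
  have hc0 : c ≠ 0 := by
    rintro h
    rw [h] at hb'
    simp at hb'
    exact hb0 hb'
  -- This is p = r²/b as a root of (τ² − κ/4)p² + (1 − 2aτ)p = v − a², in the rationalized form that
  -- also covers 4τ² = κ.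
  have hp : 4 * R / b = 2 * (v - a ^ 2) / c := by
    rw [hR, hb']
    field_simp
    ring
  have hi : 1 / b = 1 - κ / 4 * (2 * (v - a ^ 2) / c) := by
    rw [← hp]
    field_simp
    linear_combination -hb
  have hw' : w = 2 / b - 1 - 2 * τ * q := by
    have h2 : 2 / b - 1 - 2 * τ * q = 2 * (1 / b) - 1 - 2 * τ * (a - τ * (4 * R / b)) := by
      rw [hq]; ring
    rw [h2, hi, hp]
    field_simp
    linear_combination 4 * hw + w * hc - (1 - 2 * a * τ) * hc
  refine ⟨?_, hw'⟩
  have h1 : 4 * R / b ^ 2 + q ^ 2 = (4 * R / b) * (1 / b) + (a - τ * (4 * R / b)) ^ 2 := by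
    rw [hq]; ring
  rw [h1, hi, hp]
  field_simp
  linear_combination (v - a ^ 2) * (4 * hw + w * hc - (1 - 2 * a * τ) * hc)

/-- The derivative of the ratio `(v - a²) / D` in closed form. -/
theorem bour_ratio_deriv {κ τ a v v' w D : ℝ} (hD : D = (1 + w) ^ 2 - 4 * τ ^ 2 * v)
    (hw : w ^ 2 = (1 - 2 * a * τ) ^ 2 + (v - a ^ 2) * (4 * τ ^ 2 - κ)) (hw0 : w ≠ 0)
    (hD0 : D ≠ 0) :
    (v' * D - (v - a ^ 2) * (2 * (1 + w) * (v' * (4 * τ ^ 2 - κ) / (2 * w)) - 4 * τ ^ 2 * v')) /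
        D ^ 2 = v' * (2 * ((1 - 2 * a * τ + w) / D)) ^ 2 / (4 * w) := by
  -- The numerator of the derivative reduces to a perfect square, which produces the squared
  -- conformal factor.
  have h : w * D - (v - a ^ 2) * ((1 + w) * (4 * τ ^ 2 - κ) - 4 * τ ^ 2 * w) =
      (1 - 2 * a * τ + w) ^ 2 := by
    rw [hD]
    linear_combination (1 + w) * hw
  field_simp
  linear_combination 4 * v' * h

/-! ### Derivatives of the Bour data -/

section Derivatives

variable {κ τ m a : ℝ} {U : ℝ → ℝ} {u : ℝ}

theorem hasDerivAt_Delta (hU : DifferentiableAt ℝ U u) :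
    HasDerivAt (Delta κ τ m a U)
      (2 * m ^ 2 * U u * deriv U u * (4 * τ ^ 2 - κ)) u := by
  have h := ((((hU.hasDerivAt.fun_pow 2).const_mul (m ^ 2)).sub_const (a ^ 2)).mul_const
    (4 * τ ^ 2 - κ)).const_add ((1 - 2 * a * τ) ^ 2)
  refine HasDerivAt.congr_deriv (f := Delta κ τ m a U) h ?_
  norm_num only [Nat.cast_ofNat, pow_one]
  ring

theorem sqrt_Delta_sq (hD : 0 < Delta κ τ m a U u) :
    √(Delta κ τ m a U u) ^ 2 =
      (1 - 2 * a * τ) ^ 2 + (m ^ 2 * U u ^ 2 - a ^ 2) * (4 * τ ^ 2 - κ) :=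
  Real.sq_sqrt hD.le

/-- Division by zero yields 0, so positivity of the quotient already excludes a zero denominator. -/
theorem denom_ne_zero (hR : 0 < ratio κ τ m a U u) :
    (1 + √(Delta κ τ m a U u)) ^ 2 - 4 * τ ^ 2 * m ^ 2 * U u ^ 2 ≠ 0 := by
  intro h
  rw [ratio, h, div_zero] at hR
  exact hR.false

theorem xi1_pos (hR : 0 < ratio κ τ m a U u) : 0 < xi1 κ τ m a U u := by
  have := Real.sqrt_pos.2 hR
  rw [xi1]
  positivity

theorem xi1_sq (hR : 0 < ratio κ τ m a U u) :
    xi1 κ τ m a U u ^ 2 = 4 * ratio κ τ m a U u := by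
  rw [xi1, mul_pow, Real.sq_sqrt hR.le]
  norm_num

/-- The function `B` is the conformal factor along the surface. -/
theorem conf_xi1 (hD : 0 < Delta κ τ m a U u) (hR : 0 < ratio κ τ m a U u) :
    1 + κ / 4 * xi1 κ τ m a U u ^ 2 = B κ τ m a U u := by
  rw [xi1_sq hR, B, ← conf_ratio (v := m ^ 2 * U u ^ 2) (by ring) (sqrt_Delta_sq hD) rfl
    (denom_ne_zero hR), ratio]
  ring

theorem hasDerivAt_sqrt_Delta (hU : DifferentiableAt ℝ U u) (hD : 0 < Delta κ τ m a U u) :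
    HasDerivAt (fun s => √(Delta κ τ m a U s))
      (2 * m ^ 2 * U u * deriv U u * (4 * τ ^ 2 - κ) / (2 * √(Delta κ τ m a U u))) u :=
  (hasDerivAt_Delta hU).sqrt hD.ne'

theorem hasDerivAt_ratio (hU : DifferentiableAt ℝ U u) (hD : 0 < Delta κ τ m a U u)
    (hR : 0 < ratio κ τ m a U u) :
    HasDerivAt (ratio κ τ m a U)
      (2 * m ^ 2 * U u * deriv U u * B κ τ m a U u ^ 2 / (4 * √(Delta κ τ m a U u))) u := by
  have hV := ((hU.hasDerivAt.fun_pow 2).const_mul (m ^ 2)).sub_const (a ^ 2)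
  have hden := (((hasDerivAt_sqrt_Delta hU hD).const_add 1).fun_pow 2).fun_sub
    ((hU.hasDerivAt.fun_pow 2).const_mul (4 * τ ^ 2 * m ^ 2))
  refine HasDerivAt.congr_deriv (f := ratio κ τ m a U) (hV.fun_div hden (denom_ne_zero hR)) ?_
  rw [B, ← bour_ratio_deriv (v := m ^ 2 * U u ^ 2) (by ring) (sqrt_Delta_sq hD)
    (Real.sqrt_pos.2 hD).ne' (denom_ne_zero hR)]
  simp
  ring

/-- This is rr' = b²K. The factor K = m²(UU'/√Δ) is kept intact because its derivative is what
enters the final equation. -/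
theorem hasDerivAt_xi1 (hU : DifferentiableAt ℝ U u) (hD : 0 < Delta κ τ m a U u)
    (hR : 0 < ratio κ τ m a U u) :
    HasDerivAt (xi1 κ τ m a U)
      ((1 + κ / 4 * xi1 κ τ m a U u ^ 2) ^ 2 *
        (m ^ 2 * (U u * deriv U u / √(Delta κ τ m a U u))) / xi1 κ τ m a U u) u := by
  refine HasDerivAt.congr_deriv (f := xi1 κ τ m a U)
    (((hasDerivAt_ratio hU hD hR).sqrt hR.ne').const_mul 2) ?_
  have := Real.sqrt_pos.2 hR
  have := Real.sqrt_pos.2 hD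
  rw [conf_xi1 hD hR, xi1]
  field_simp
  ring

/-- Since (4 + κr²)/4 is the conformal factor b, the radicand is r² − b²K². -/
theorem radicand_eq (hD : 0 < Delta κ τ m a U u) :
    radicand κ τ m a U u = xi1 κ τ m a U u ^ 2 -
      (1 + κ / 4 * xi1 κ τ m a U u ^ 2) ^ 2 *
        (m ^ 2 * (U u * deriv U u / √(Delta κ τ m a U u))) ^ 2 := by
  rw [radicand, mul_pow, div_pow, Real.sq_sqrt hD.le]
  field_simp
  ring

theorem hasDerivAt_conf_xi1 {r' : ℝ} (hr : HasDerivAt (xi1 κ τ m a U) r' u) :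
    HasDerivAt (fun s => 1 + κ / 4 * xi1 κ τ m a U s ^ 2)
      (κ / 2 * xi1 κ τ m a U u * r') u := by
  refine (((hr.fun_pow 2).const_mul (κ / 4)).const_add 1).congr_deriv ?_
  simp
  ring

end Derivatives

/-! ### The Bour surfaces and the differential equation -/

/-- The mean curvature of a surface of the Bour family. -/
theorem meanCurvature_bourSurface {κ τ m a : ℝ} (hm : m ≠ 0)
    {I : Set ℝ} (hIo : IsOpen I) (hIc : I.OrdConnected)
    {U : ℝ → ℝ} (hU : ContDiffOn ℝ 2 U I) (hUpos : ∀ u ∈ I, 0 < U u)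
    (hDelta : ∀ u ∈ I, 0 < Delta κ τ m a U u) (hxi1 : ∀ u ∈ I, 0 < ratio κ τ m a U u)
    (hdom : ∀ u ∈ I, 0 < 1 + κ / 4 * xi1 κ τ m a U u ^ 2)
    (hrad : ∀ u ∈ I, 0 < radicand κ τ m a U u)
    {u₀ : ℝ} (hu₀ : u₀ ∈ I) (c d : ℝ) {u : ℝ} (hu : u ∈ I) (t : ℝ) :
    meanCurvature (metric κ τ) (bourSurface κ τ m a U u₀ c d) u t =
      (2 - B κ τ m a U u - B κ τ m a U u *
        (m ^ 2 * deriv (fun s => U s * deriv U s / √(Delta κ τ m a U s)) u)) /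
        √(radicand κ τ m a U u) := by
  have hU1 : ∀ s ∈ I, DifferentiableAt ℝ U s := fun s hs =>
    (hU.differentiableOn (by norm_num)).differentiableAt (hIo.mem_nhds hs)
  have hU2 : ∀ s ∈ I, DifferentiableAt ℝ (deriv U) s := fun s hs =>
    ((hU.deriv_of_isOpen (m := 1) hIo (by norm_num)).differentiableOn
      (by norm_num)).differentiableAt (hIo.mem_nhds hs)
  set r := xi1 κ τ m a U with hr_def
  set b : ℝ → ℝ := fun s => 1 + κ / 4 * r s ^ 2 with hb_def
  set w : ℝ → ℝ := fun s => √(Delta κ τ m a U s) with hw_def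
  set J : ℝ → ℝ := fun s => U s * deriv U s / √(Delta κ τ m a U s) with hJ_def
  set lam : ℝ → ℝ := fun s => √(radicand κ τ m a U s) with hlam_def
  set q : ℝ → ℝ := fun s => a - τ * r s ^ 2 / b s with hq_def
  have hr0 : ∀ s ∈ I, 0 < r s := fun s hs => xi1_pos (hxi1 s hs)
  have hb0 : ∀ s ∈ I, 0 < b s := hdom
  have hw0 : ∀ s ∈ I, 0 < w s := fun s hs => Real.sqrt_pos.2 (hDelta s hs)
  have hlam0 : ∀ s ∈ I, 0 < lam s := fun s hs => Real.sqrt_pos.2 (hrad s hs)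
  have hr1 : ∀ s ∈ I, HasDerivAt r (b s ^ 2 * (m ^ 2 * J s) / r s) s := fun s hs =>
    hasDerivAt_xi1 (hU1 s hs) (hDelta s hs) (hxi1 s hs)
  have hb1 : ∀ s ∈ I, HasDerivAt b (κ / 2 * r s * (b s ^ 2 * (m ^ 2 * J s) / r s)) s :=
    fun s hs => hasDerivAt_conf_xi1 (hr1 s hs)
  have hJ1 : ∀ s ∈ I, HasDerivAt J (deriv J s) s := fun s hs =>
    (((hU1 s hs).mul (hU2 s hs)).div
      (hasDerivAt_sqrt_Delta (hU1 s hs) (hDelta s hs)).differentiableAt (hw0 s hs).ne').hasDerivAt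
  have hlam2 : ∀ s ∈ I, lam s ^ 2 = r s ^ 2 - b s ^ 2 * (m ^ 2 * J s) ^ 2 := fun s hs => by
    rw [← radicand_eq (hDelta s hs)]
    exact Real.sq_sqrt (hrad s hs).le
  have hrel : ∀ s ∈ I, (m * U s) ^ 2 = r s ^ 2 / b s ^ 2 + q s ^ 2 ∧
      w s = 2 / b s - 1 - 2 * τ * q s := fun s hs => by
    have h := bour_relations (v := m ^ 2 * U s ^ 2) (by ring) (sqrt_Delta_sq (hDelta s hs)) rfl
      (denom_ne_zero (hxi1 s hs)) (hb0 s hs).ne' (q := q s)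
      (by rw [hb_def, hr_def]; simp only [xi1_sq (hxi1 s hs), ratio]; ring)
      (by rw [← ratio, ← xi1_sq (hxi1 s hs)])
    rw [← ratio, ← xi1_sq (hxi1 s hs)] at h
    exact ⟨by rw [mul_pow, h.1], h.2⟩
  have hlam1 : ∀ s ∈ I, HasDerivAt lam
      ((r s * (b s ^ 2 * (m ^ 2 * J s) / r s) -
        b s * (κ / 2 * r s * (b s ^ 2 * (m ^ 2 * J s) / r s)) * (m ^ 2 * J s) ^ 2 -
        b s ^ 2 * (m ^ 2 * J s) * (m ^ 2 * deriv J s)) / lam s) s := fun s hs => by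
    have h := ((((hr1 s hs).fun_pow 2).fun_sub (((hb1 s hs).fun_pow 2).fun_mul
      (((hJ1 s hs).const_mul (m ^ 2)).fun_pow 2))).congr_of_eventuallyEq
      (Filter.eventuallyEq_of_mem (hIo.mem_nhds hs) fun x hx => radicand_eq (hDelta x hx))).sqrt
      (hrad s hs).ne'
    refine h.congr_deriv ?_
    have := (hlam0 s hs).ne'
    have := (hr0 s hs).ne'
    change _ / (2 * lam s) = _
    simp
    field_simp
    ring
  set f : ℝ → ℝ := fun s => m * U s * (4 + κ * r s ^ 2) / (4 * r s ^ 2) * lam s with hf_def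
  set g : ℝ → ℝ := fun s =>
    ((4 * τ - a * κ) * r s ^ 2 - 4 * a) / (4 * m * U s * r s ^ 2) * lam s with hg_def
  have hfeq : ∀ s, f s = m * U s * b s * lam s / r s ^ 2 := fun s => by
    simp only [hf_def, hb_def]
    ring
  have hgeq : ∀ s ∈ I, g s = -(b s * q s * lam s) / (m * U s * r s ^ 2) := fun s hs => by
    -- Multiplied by −4, this is the numerator (4τ − aκ)r² − 4a in the integrand of θ.
    have h1 : b s * q s = a * b s - τ * r s ^ 2 := by
      have := (hb0 s hs).ne'
      simp only [hq_def]
      field_simp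
    rw [h1]
    have := (hUpos s hs).ne'
    have := (hr0 s hs).ne'
    simp only [hg_def, hb_def]
    field_simp
    ring
  have hf1 : ∀ s ∈ I, HasDerivAt f
      (w s * (m ^ 2 * J s) * b s * lam s / (m * U s * r s ^ 2) +
        m * U s * (κ / 2 * r s * (b s ^ 2 * (m ^ 2 * J s) / r s)) * lam s / r s ^ 2 +
        m * U s * b s * ((r s * (b s ^ 2 * (m ^ 2 * J s) / r s) -
          b s * (κ / 2 * r s * (b s ^ 2 * (m ^ 2 * J s) / r s)) * (m ^ 2 * J s) ^ 2 -
          b s ^ 2 * (m ^ 2 * J s) * (m ^ 2 * deriv J s)) / lam s) / r s ^ 2 -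
        2 * m * U s * b s * lam s * (b s ^ 2 * (m ^ 2 * J s) / r s) / r s ^ 3) s := fun s hs => by
    have h := (((((hU1 s hs).hasDerivAt.const_mul m).fun_mul (hb1 s hs)).fun_mul
      (hlam1 s hs)).fun_div ((hr1 s hs).fun_pow 2) (pow_ne_zero 2 (hr0 s hs).ne'))
    refine HasDerivAt.congr_deriv (h.congr_of_eventuallyEq (.of_forall hfeq)) ?_
    have h1 := (hlam0 s hs).ne'
    have h2 := (hr0 s hs).ne'
    have h3 := (hUpos s hs).ne'
    -- Expressing U' through √Δ and J makes f' algebraic in the variables of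
    -- `meanCurvature_helicoidal`, where √Δ is 2/b − 1 − 2τq.
    have h4 : deriv U s = w s * J s / U s := by
      have := (hw0 s hs).ne'
      simp only [hJ_def]
      rw [hw_def] at this ⊢
      field_simp
    rw [h4]
    simp only [Nat.cast_ofNat, Nat.add_one_sub_one, pow_one]
    generalize hJs : J s = j at *
    generalize deriv J s = j' at *
    generalize b s = bs at *
    generalize w s = ws at *
    generalize lam s = ls at *
    generalize r s = rs at *
    field_simp
  -- Mere differentiability suffices: θ'' multiplies a vector proportional to ∂ₜX, which is tangent
  -- to the surface, so its value never matters.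
  have hg1 : ∀ s ∈ I, DifferentiableAt ℝ g s := fun s hs => by
    have hr' := (hr1 s hs).differentiableAt
    have hl' := (hlam1 s hs).differentiableAt
    have hU' := hU1 s hs
    have h2 := (hr0 s hs).ne'
    have h3 := (hUpos s hs).ne'
    exact (((hr'.pow 2).const_mul _ |>.sub_const _).div
      ((hU'.const_mul _).mul (hr'.pow 2)) (by simp [hm, h2, h3])).mul hl'
  have hζ : ∀ s ∈ I, HasDerivAt (xi2 κ τ m a U u₀ c) (f s) s := fun s hs =>
    (hasDerivAt_integral_of_continuousOn hIo hIc
      (fun x hx => (hf1 x hx).continuousAt.continuousWithinAt) hu₀ hs).const_add c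
  have hθ : ∀ s ∈ I, HasDerivAt (fun x => theta κ τ m a U u₀ d x t) (g s) s := fun s hs =>
    ((hasDerivAt_integral_of_continuousOn hIo hIc
      (fun x hx => (hg1 x hx).continuousAt.continuousWithinAt) hu₀ hs).const_add d).const_add _
  have hθt : ∀ y, HasDerivAt (fun x => theta κ τ m a U u₀ d u x) (1 / m) y := fun y =>
    ((hasDerivAt_id y).div_const m).add_const _
  have hX : ∀ s y, bourSurface κ τ m a U u₀ c d s y = cyl (theta κ τ m a U u₀ d s y) (r s) 0
      (xi2 κ τ m a U u₀ c s + a * theta κ τ m a U u₀ d s y) := fun s y => by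
    simp [bourSurface, cyl, hr_def]
  have hXu : ∀ s ∈ I, dU (bourSurface κ τ m a U u₀ c d) s t =
      cyl (theta κ τ m a U u₀ d s t) (b s ^ 2 * (m ^ 2 * J s) / r s) (r s * g s)
        (f s + a * g s) := fun s hs => by
    rw [dU]
    simp only [hX]
    rw [(hasDerivAt_cyl (hθ s hs) (hr1 s hs) (hasDerivAt_const s 0)
      ((hζ s hs).fun_add ((hθ s hs).const_mul a))).deriv]
    simp
  have hXt : ∀ y, dT (bourSurface κ τ m a U u₀ c d) u y =
      cyl (theta κ τ m a U u₀ d u y) 0 (r u / m) (a / m) := fun y => by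
    rw [dT]
    simp only [hX]
    rw [(hasDerivAt_cyl (hθt y) (hasDerivAt_const y (r u)) (hasDerivAt_const y 0)
      (((hθt y).const_mul a).const_add _)).deriv]
    simp [div_eq_mul_inv]
  have hXtt : dT (dT (bourSurface κ τ m a U u₀ c d)) u t =
      cyl (theta κ τ m a U u₀ d u t) (-(r u / m ^ 2)) 0 0 := by
    rw [dT]
    simp only [hXt]
    rw [(hasDerivAt_cyl (hθt t) (hasDerivAt_const t 0) (hasDerivAt_const t (r u / m))
      (hasDerivAt_const t (a / m))).deriv]
    congr 1
    · field_simp; ring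
    · ring
  have hr2 : HasDerivAt (fun s => b s ^ 2 * (m ^ 2 * J s) / r s)
      ((2 * b u * (κ / 2 * r u * (b u ^ 2 * (m ^ 2 * J u) / r u)) * (m ^ 2 * J u) +
        b u ^ 2 * (m ^ 2 * deriv J u)) / r u -
        b u ^ 2 * (m ^ 2 * J u) * (b u ^ 2 * (m ^ 2 * J u) / r u) / r u ^ 2) u := by
    refine ((((hb1 u hu).fun_pow 2).fun_mul ((hJ1 u hu).const_mul (m ^ 2))).fun_div (hr1 u hu)
      (hr0 u hu).ne').congr_deriv ?_
    have := (hr0 u hu).ne'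
    simp
    field_simp
  -- The formula for ∂ᵤX is known only on I; openness of I makes it hold near u, so it can be
  -- differentiated.
  have hXuu := (Filter.EventuallyEq.deriv_eq (Filter.eventuallyEq_of_mem (hIo.mem_nhds hu) hXu)).trans
    (hasDerivAt_cyl (hθ u hu) hr2 ((hr1 u hu).fun_mul (hg1 u hu).hasDerivAt)
      ((hf1 u hu).fun_add ((hg1 u hu).hasDerivAt.const_mul a))).deriv
  have hB : B κ τ m a U u = b u := (conf_xi1 (hDelta u hu) (hxi1 u hu)).symm
  rw [hB]
  exact meanCurvature_helicoidal hm (hr0 u hu) (hb0 u hu) (hUpos u hu) (hlam0 u hu) rfl rfl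
    (hrel u hu).1 (hlam2 u hu) rfl rfl (hrel u hu).2 rfl (hgeq u hu) (hfeq u) rfl (hX u t)
    (hXu u hu) (hXt t) (hXuu.trans (by congr 1 <;> ring)) hXtt

end BCV

theorem proposition4p2 (κ τ m a H : ℝ) (hm : m ≠ 0)
    (I : Set ℝ) (hIo : IsOpen I) (hIc : I.OrdConnected)
    (U : ℝ → ℝ) (hU : ContDiffOn ℝ 2 U I) (hUpos : ∀ u ∈ I, 0 < U u)
    (hDelta : ∀ u ∈ I, 0 < BCV.Delta κ τ m a U u)
    (hxi1 : ∀ u ∈ I, 0 < BCV.ratio κ τ m a U u)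
    (hdom : ∀ u ∈ I, 0 < 1 + κ / 4 * BCV.xi1 κ τ m a U u ^ 2)
    (hrad : ∀ u ∈ I, 0 < BCV.radicand κ τ m a U u)
    (u₀ : ℝ) (hu₀ : u₀ ∈ I) (c d : ℝ) :
    (∀ u ∈ I, ∀ t : ℝ,
        BCV.meanCurvature (BCV.metric κ τ) (BCV.bourSurface κ τ m a U u₀ c d) u t = H) ↔
      ∀ u ∈ I,
        H * √(4 * (m ^ 2 * U u ^ 2 - a ^ 2) /
              ((1 + √(BCV.Delta κ τ m a U u)) ^ 2 - 4 * τ ^ 2 * m ^ 2 * U u ^ 2) -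
            m ^ 4 * BCV.B κ τ m a U u ^ 2 * U u ^ 2 * deriv U u ^ 2 /
              BCV.Delta κ τ m a U u) =
          2 - BCV.B κ τ m a U u -
            m ^ 2 * BCV.B κ τ m a U u *
              deriv (fun s => U s * deriv U s / √(BCV.Delta κ τ m a U s)) u := by
  refine forall₂_congr fun u hu => ?_
  have hQ : 4 * (m ^ 2 * U u ^ 2 - a ^ 2) /
      ((1 + √(BCV.Delta κ τ m a U u)) ^ 2 - 4 * τ ^ 2 * m ^ 2 * U u ^ 2) -
      m ^ 4 * BCV.B κ τ m a U u ^ 2 * U u ^ 2 * deriv U u ^ 2 / BCV.Delta κ τ m a U u =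
      BCV.radicand κ τ m a U u := by
    rw [BCV.radicand, ← BCV.conf_xi1 (hDelta u hu) (hxi1 u hu), BCV.xi1_sq (hxi1 u hu), BCV.ratio]
    have := (hDelta u hu).ne'
    generalize (1 + √(BCV.Delta κ τ m a U u)) ^ 2 - 4 * τ ^ 2 * m ^ 2 * U u ^ 2 = D
    ring
  have hpos := Real.sqrt_pos.2 (hrad u hu)
  -- The mean curvature does not depend on t, so the quantifier over t disappears.
  simp only [BCV.meanCurvature_bourSurface hm hIo hIc hU hUpos hDelta hxi1 hdom hrad hu₀ c d hu,
    forall_const, hQ]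
  rw [div_eq_iff hpos.ne', eq_comm, ← mul_assoc, mul_comm (BCV.B κ τ m a U u) (m ^ 2)]
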